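/- Let $\mathcal M$ be a loop-free matroid on the ground set $[n]=\{1,\dots,n\}$ with set of circuits $\mathfrak C(\mathcal M)$, let $\mathbb K$ be a field, and let $\beta_{i,j}\in\mathbb K^*$ for $1\le i<j\le n$. Let $\mathcal A$ be the $\mathbb K$-algebra generated by $e_1,\dots,e_n$ subject to the relations $e_i^2=0$ for all $i$ and $e_je_i=\beta_{i,j}e_ie_j$ for $i<j$. For $X=\{i_1<\dots<i_m\}\subseteq[n]$ put $e_X:=e_{i_1}\cdots e_{i_m}$, with $e_\emptyset:=1$; these monomials form a basis of $\mathcal A$. Given a map $\chi:2^{[n]}\to\mathbb K$, let $\partial:\mathcal A\to\mathcal A$ be the linear map with $\partial e_\emptyset=0$, $\partial e_i=1$, and $$\partial e_X=\sum_{p=1}^{m}(-1)^p\,\chi(X\setminus i_p)\,e_{X\setminus i_p}\qquad\text{for } X=\{i_1<\dots<i_m\},\ m\ge 2.$$ A set $U\subseteq[n]$ is called unidependent if it contains exactly one circuit of $\mathcal M$. Suppose that (1) $\chi(I)\neq0$ if and only if $I$ is independent in $\mathcal M$; (2) for any two unidependent sets $U'\subseteq U$ there is a scalar $\varepsilon\in\mathbb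 K^*$ with $\partial e_U=\varepsilon\,(\partial e_{U'})\,e_{U\setminus U'}$. Let $\mathfrak I_\chi(\mathcal M)$ (the $\chi$-ideal) be the right ideal of $\mathcal A$ generated by $\{\partial e_C: C\in\mathfrak C(\mathcal M)\}$. A term order is a total order $\prec$ on the set of monomials $e_X$ with least element $e_\emptyset=1$ such that, whenever $e_X\prec e_Y$, $e_Xe_Z\ne0$ and $e_Ye_Z\neq0$, one has $e_Xe_Z\prec e_Ye_Z$ (nonzero products of monomials being compared up to nonzero scalars). For $0\ne f\in\mathcal A$ let $\mathrm{lp}_\prec(f)$ be the largest monomial occurring in $f$ with nonzero coefficient, let $\mathrm{lp}_\prec(0)=0$, and for $S\subseteq\mathcal A$ let $\mathrm{Lt}_\prec(S)$ be the ideal generated by $\{\mathrm{lp}_\prec(f):f\in S\}$. A set $\mathcal G$ of nonzero elements of $\mathfrak I_\chi(\mathcal M)$ is a Gröbner basis of $\mathfrak I_\chi(\mathcal M)$ with respect to $\prec$ if $\mathrm{Lt}_\prec(\mathcal G)=\mathrm{Lt}_\prec(\mathfrak I_\chi(\mathcal M))$, and a universal Gröbner basis if this holds for all term orders simultaneously.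 Then $\mathcal G_u:=\{\partial e_C: C\in\mathfrak C(\mathcal M)\}$ is a universal Gröbner basis of $\mathfrak I_\chi(\mathcal M)$, and it is minimal for inclusion among the universal Gröbner bases of $\mathfrak I_\chi(\mathcal M)$. -/

import Mathlib

open Finset

namespace ChiAlgebra

section Algebra

variable {K : Type*} [Field K] {n : ℕ}

/-- The scalar produced when the sorted monomial `e_X` is multiplied by the sorted monomial `e_Y`
(`X`, `Y` disjoint): one factor `β y x` for every inversion `y < x`, `x ∈ X`, `y ∈ Y`. -/
def inv (β : Fin n → Fin n → Kˣ) (X Y : Finset (Fin n)) : K :=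
  ∏ x ∈ X, ∏ y ∈ Y with y < x, (β y x : K)

/-- The graded `K`-algebra generated by `e_i` (`i : Fin n`) subject to `e_i ^ 2 = 0` and
`e_j * e_i = β i j • (e_i * e_j)` for `i < j`, realised on its basis of monomials `e_X`,
`X ⊆ Fin n`: an element is the family of its coefficients. Only the values `β i j` with `i < j`
matter. That this is the algebra with this presentation is `mono_eq_prod`, `gen_mul_self`,
`gen_mul_gen` and `existsUnique_lift` below. -/
def Alg {K : Type*} [Field K] {n : ℕ} (_β : Fin n → Fin n → Kˣ) : Type _ := Finset (Fin n) → K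

variable (β : Fin n → Fin n → Kˣ)

instance : AddCommGroup (Alg β) := inferInstanceAs (AddCommGroup (Finset (Fin n) → K))

instance : Module K (Alg β) := inferInstanceAs (Module K (Finset (Fin n) → K))

/-- The coefficient of the monomial `e_X` in `f`. -/
def coeff {β : Fin n → Fin n → Kˣ} (f : Alg β) (X : Finset (Fin n)) : K := f X

/-- The monomial `e_X = e_{i_1} ⋯ e_{i_m}`, where `X = {i_1 < ⋯ < i_m}`. -/
def mono (X : Finset (Fin n)) : Alg β := (Pi.single X (1 : K) : Finset (Fin n) → K)

instance : One (Alg β) := ⟨mono β ∅⟩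

instance : Mul (Alg β) :=
  ⟨fun f g Z => ∑ X ∈ Z.powerset, inv β X (Z \ X) * (coeff f X * coeff g (Z \ X))⟩

variable {β}

theorem one_def : (1 : Alg β) = mono β ∅ := rfl

theorem coeff_mul (f g : Alg β) (Z : Finset (Fin n)) :
    coeff (f * g) Z = ∑ X ∈ Z.powerset, inv β X (Z \ X) * (coeff f X * coeff g (Z \ X)) := rfl

theorem coeff_add (f g : Alg β) (Z : Finset (Fin n)) : coeff (f + g) Z = coeff f Z + coeff g Z := rfl

theorem coeff_smul (c : K) (f : Alg β) (Z : Finset (Fin n)) : coeff (c • f) Z = c * coeff f Z := rfl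

theorem coeff_zero (Z : Finset (Fin n)) : coeff (0 : Alg β) Z = 0 := rfl

theorem coeff_mono (X Z : Finset (Fin n)) : coeff (mono β X) Z = if Z = X then 1 else 0 :=
  Pi.single_apply X (1 : K) Z

theorem inv_empty_left (Y : Finset (Fin n)) : inv β ∅ Y = 1 := by simp [inv]

theorem inv_empty_right (X : Finset (Fin n)) : inv β X ∅ = 1 := by simp [inv]

theorem inv_ne_zero (X Y : Finset (Fin n)) : inv β X Y ≠ 0 := by
  simp [inv, Finset.prod_ne_zero_iff]

theorem inv_union_left {X Y : Finset (Fin n)} (h : Disjoint X Y) (Z : Finset (Fin n)) :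
    inv β (X ∪ Y) Z = inv β X Z * inv β Y Z := by
  simp [inv, Finset.prod_union h]

theorem inv_union_right (X : Finset (Fin n)) {Y Z : Finset (Fin n)} (h : Disjoint Y Z) :
    inv β X (Y ∪ Z) = inv β X Y * inv β X Z := by
  simp only [inv, ← Finset.prod_mul_distrib]
  refine Finset.prod_congr rfl fun x _ => ?_
  rw [Finset.filter_union, Finset.prod_union (Finset.disjoint_filter_filter h)]

theorem ext {f g : Alg β} (h : ∀ X, coeff f X = coeff g X) : f = g := funext h

theorem alg_mul_assoc (f g h : Alg β) : f * g * h = f * (g * h) := by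
  refine ext fun Z => ?_
  simp only [coeff_mul, Finset.mul_sum, Finset.sum_mul]
  rw [Finset.sum_sigma', Finset.sum_sigma']
  refine Finset.sum_bij' (fun p _ => ⟨p.2, p.1 \ p.2⟩) (fun p _ => ⟨p.1 ∪ p.2, p.1⟩)
    ?_ ?_ ?_ ?_ ?_
  · rintro ⟨W, X⟩ hp
    simp only [Finset.mem_sigma, Finset.mem_powerset] at hp ⊢
    exact ⟨hp.2.trans hp.1, Finset.sdiff_subset_sdiff hp.1 le_rfl⟩
  · rintro ⟨X, Y⟩ hp
    simp only [Finset.mem_sigma, Finset.mem_powerset] at hp ⊢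
    exact ⟨Finset.union_subset hp.1 (hp.2.trans Finset.sdiff_subset), Finset.subset_union_left⟩
  · rintro ⟨W, X⟩ hp
    simp only [Finset.mem_sigma, Finset.mem_powerset] at hp
    simp [Finset.union_sdiff_of_subset hp.2]
  · rintro ⟨X, Y⟩ hp
    simp only [Finset.mem_sigma, Finset.mem_powerset] at hp
    have : Disjoint X Y := (Finset.disjoint_sdiff).mono_right hp.2
    simp [Finset.union_sdiff_cancel_left this]
  · rintro ⟨W, X⟩ hp
    simp only [Finset.mem_sigma, Finset.mem_powerset] at hp
    obtain ⟨hW, hX⟩ := hp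
    have e1 : (Z \ X) \ (W \ X) = Z \ W := by
      ext a
      have := @hX a
      simp only [Finset.mem_sdiff]
      tauto
    have e2 : Z \ X = (W \ X) ∪ (Z \ W) := by
      ext a
      have := @hX a
      have := @hW a
      simp only [Finset.mem_sdiff, Finset.mem_union]
      tauto
    have d1 : Disjoint (W \ X) (Z \ W) := Finset.disjoint_sdiff.mono_left Finset.sdiff_subset
    have e3 : inv β W (Z \ W) = inv β X (Z \ W) * inv β (W \ X) (Z \ W) := by
      rw [← inv_union_left Finset.disjoint_sdiff, Finset.union_sdiff_of_subset hX]
    have e4 : inv β X (Z \ X) = inv β X (W \ X) * inv β X (Z \ W) := by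
      rw [← inv_union_right _ d1, ← e2]
    simp only
    rw [e1, e3, e4]
    ring

theorem mono_mul (X Y : Finset (Fin n)) :
    mono β X * mono β Y = if Disjoint X Y then inv β X Y • mono β (X ∪ Y) else 0 := by
  refine ext fun Z => ?_
  rw [coeff_mul]
  simp only [coeff_mono]
  by_cases hX : X ⊆ Z
  · rw [Finset.sum_eq_single X (fun b _ hb => by simp [hb])
      (fun h => absurd (Finset.mem_powerset.2 hX) h)]
    by_cases hY : Z \ X = Y
    · subst hY
      rw [if_pos Finset.disjoint_sdiff, coeff_smul, coeff_mono,
        if_pos (Finset.union_sdiff_of_subset hX).symm]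
      simp
    · simp only [if_neg hY, mul_zero]
      split_ifs with hd
      · rw [coeff_smul, coeff_mono, if_neg, mul_zero]
        rintro rfl
        exact hY (Finset.union_sdiff_cancel_left hd)
      · rfl
  · rw [Finset.sum_eq_zero]
    · split_ifs with hd
      · rw [coeff_smul, coeff_mono, if_neg, mul_zero]
        rintro rfl
        exact hX Finset.subset_union_left
      · rfl
    · intro W hW
      have : W ≠ X := fun h => hX (h ▸ Finset.mem_powerset.1 hW)
      simp [this]

variable (β)

instance : Ring (Alg β) :=
  { (inferInstance : AddCommGroup (Alg β)), (inferInstance : Mul (Alg β)),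
    (inferInstance : One (Alg β)) with
    left_distrib := fun f g h => ext fun Z => by
      simp only [coeff_mul, coeff_add, mul_add, Finset.sum_add_distrib]
    right_distrib := fun f g h => ext fun Z => by
      simp only [coeff_mul, coeff_add, add_mul, mul_add, Finset.sum_add_distrib]
    zero_mul := fun f => ext fun Z => by simp [coeff_mul, coeff_zero]
    mul_zero := fun f => ext fun Z => by simp [coeff_mul, coeff_zero]
    mul_assoc := alg_mul_assoc
    one_mul := fun f => ext fun Z => by
      rw [coeff_mul, Finset.sum_eq_single ∅]
      · simp [one_def, coeff_mono, inv_empty_left]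
      · intro W _ hW
        simp [one_def, coeff_mono, hW]
      · simp
    mul_one := fun f => ext fun Z => by
      rw [coeff_mul, Finset.sum_eq_single Z]
      · simp [one_def, coeff_mono, inv_empty_right]
      · intro W hW hWZ
        have : ¬ Z ⊆ W := fun h => hWZ (subset_antisymm (Finset.mem_powerset.1 hW) h)
        simp [one_def, coeff_mono, Finset.sdiff_eq_empty_iff_subset, this]
      · simp }

instance : Algebra K (Alg β) :=
  Algebra.ofModule
    (fun c f g => ext fun Z => by
      simp only [coeff_mul, coeff_smul, Finset.mul_sum]
      exact Finset.sum_congr rfl fun _ _ => by ring)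
    (fun c f g => ext fun Z => by
      simp only [coeff_mul, coeff_smul, Finset.mul_sum]
      exact Finset.sum_congr rfl fun _ _ => by ring)

/-- The generator `e_i`. -/
def gen (i : Fin n) : Alg β := mono β {i}

variable {β}

theorem mono_mul_mono_ne_zero_iff (X Y : Finset (Fin n)) :
    mono β X * mono β Y ≠ 0 ↔ Disjoint X Y := by
  rw [mono_mul]
  split_ifs with h
  · refine iff_of_true (fun h0 => ?_) h
    have := congrArg (fun f => coeff f (X ∪ Y)) h0
    rw [coeff_smul, coeff_mono, coeff_zero] at this
    simp [inv_ne_zero] at this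
  · simp [h]

theorem eq_sum_mono (f : Alg β) : f = ∑ X, coeff f X • mono β X := by
  refine ext fun Z => ?_
  let p : Alg β →+ K := AddMonoidHom.mk' (fun g => coeff g Z) fun g h => coeff_add g h Z
  have hp : ∀ g, coeff g Z = p g := fun _ => rfl
  rw [hp (∑ X, _), map_sum]
  simp only [← hp, coeff_smul, coeff_mono]
  simp

theorem gen_mul_self (i : Fin n) : gen β i * gen β i = 0 := by
  simp [gen, mono_mul]

theorem gen_mul_gen {i j : Fin n} (h : i < j) :
    gen β j * gen β i = (β i j : K) • (gen β i * gen β j) := by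
  have h1 : ({j} : Finset (Fin n)).filter (fun y => y < i) = ∅ := by
    simp [Finset.filter_singleton, h.not_gt]
  have h2 : ({i} : Finset (Fin n)).filter (fun y => y < j) = {i} := by
    simp [Finset.filter_singleton, h]
  simp [gen, mono_mul, h.ne, h.ne', inv, h1, h2, Finset.union_comm]

section Presentation

variable {B : Type*} [Ring B] [Algebra K B]

/-- The product, in increasing order of indices, of the family `b` over `X`. -/
def sortedProd (b : Fin n → B) (X : Finset (Fin n)) : B := ((X.sort (· ≤ ·)).map b).prod

theorem sortedProd_insert (b : Fin n → B) {a : Fin n} {X : Finset (Fin n)}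
    (h : ∀ x ∈ X, a < x) : sortedProd b (insert a X) = b a * sortedProd b X := by
  rw [sortedProd, Finset.sort_insert (r := (· ≤ ·)) (fun x hx => (h x hx).le)
    (fun ha => lt_irrefl _ (h a ha))]
  simp [sortedProd]

theorem mul_sortedProd {b : Fin n → B} (h0 : ∀ i, b i * b i = 0)
    (h1 : ∀ i j, i < j → b j * b i = (β i j : K) • (b i * b j))
    (x : Fin n) (Y : Finset (Fin n)) :
    b x * sortedProd b Y =
      if x ∈ Y then 0 else inv β {x} Y • sortedProd b (insert x Y) := by
  induction Y using Finset.induction_on_min with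
  | empty => simp [inv_empty_right, sortedProd]
  | insert a Y ha ih =>
    rcases lt_trichotomy x a with hx | rfl | hx
    · have hx' : ∀ y ∈ insert a Y, x < y := by
        intro y hy
        rcases Finset.mem_insert.1 hy with rfl | hy
        · exact hx
        · exact hx.trans (ha y hy)
      have hn : x ∉ insert a Y := fun h => lt_irrefl _ (hx' x h)
      have hf : (insert a Y).filter (fun y => y < x) = ∅ :=
        Finset.filter_eq_empty_iff.2 fun y hy => (hx' y hy).not_gt
      rw [if_neg hn, sortedProd_insert b hx']
      simp [inv, hf]
    · rw [sortedProd_insert b ha, ← mul_assoc, h0]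
      simp
    · rw [sortedProd_insert b ha, ← mul_assoc, h1 a x hx, smul_mul_assoc, mul_assoc, ih]
      by_cases hxY : x ∈ Y
      · simp [hxY]
      · have hn : x ∉ insert a Y := by simp [hxY, hx.ne']
        have haY : a ∉ Y := fun h => lt_irrefl _ (ha a h)
        have ha' : ∀ y ∈ insert x Y, a < y := by
          intro y hy
          rcases Finset.mem_insert.1 hy with rfl | hy
          · exact hx
          · exact ha y hy
        have hi : inv β {x} (insert a Y) = (β a x : K) * inv β {x} Y := by
          simp [inv, Finset.filter_insert, hx, haY]
        rw [if_neg hxY, if_neg hn, hi, mul_smul_comm, smul_smul, Finset.insert_comm,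
          sortedProd_insert b ha']

theorem sortedProd_mul_sortedProd {b : Fin n → B} (h0 : ∀ i, b i * b i = 0)
    (h1 : ∀ i j, i < j → b j * b i = (β i j : K) • (b i * b j))
    (X Y : Finset (Fin n)) :
    sortedProd b X * sortedProd b Y =
      if Disjoint X Y then inv β X Y • sortedProd b (X ∪ Y) else 0 := by
  induction X using Finset.induction_on_min with
  | empty => simp [inv_empty_left, sortedProd]
  | insert a X ha ih =>
    have haX : a ∉ X := fun h => lt_irrefl _ (ha a h)
    rw [sortedProd_insert b ha, mul_assoc, ih]
    by_cases hd : Disjoint X Y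
    · rw [if_pos hd, mul_smul_comm, mul_sortedProd h0 h1]
      by_cases haY : a ∈ Y
      · simp [haY]
      · have hf : X.filter (fun y => y < a) = ∅ :=
          Finset.filter_eq_empty_iff.2 fun y hy => (ha y hy).not_gt
        have e1 : inv β {a} (X ∪ Y) = inv β {a} Y := by
          rw [inv_union_right _ hd]
          simp [inv, hf]
        have e2 : inv β (insert a X) Y = inv β {a} Y * inv β X Y := by
          rw [Finset.insert_eq, inv_union_left (by simpa using haX)]
        rw [if_neg (by simp [haX, haY]), if_pos (by simp [haY, hd]), smul_smul, e1, e2,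
          Finset.insert_union, mul_comm]
    · simp [hd]

end Presentation

theorem mono_eq_prod (X : Finset (Fin n)) : mono β X = sortedProd (gen β) X := by
  induction X using Finset.induction_on_min with
  | empty => simp [sortedProd, one_def]
  | insert a X ha ih =>
    have haX : a ∉ X := fun h => lt_irrefl _ (ha a h)
    have hf : X.filter (fun y => y < a) = ∅ :=
      Finset.filter_eq_empty_iff.2 fun y hy => (ha y hy).not_gt
    rw [sortedProd_insert _ ha, ← ih, gen, mono_mul, if_pos (by simpa using haX)]
    rw [← Finset.insert_eq]
    simp [inv, hf]

/-- The universal property of the presentation by generators and relations. -/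
theorem existsUnique_lift {B : Type*} [Ring B] [Algebra K B] (b : Fin n → B)
    (h0 : ∀ i, b i * b i = 0) (h1 : ∀ i j, i < j → b j * b i = (β i j : K) • (b i * b j)) :
    ∃! φ : Alg β →ₐ[K] B, ∀ i, φ (gen β i) = b i := by
  let L : Alg β →ₗ[K] B :=
    Fintype.linearCombination K (sortedProd b)
  have hL : ∀ X, L (mono β X) = sortedProd b X := fun X => by
    have := Fintype.linearCombination_apply_single K (sortedProd b) X (1 : K)
    rw [one_smul] at this
    exact this
  have hmul : ∀ f g, L (f * g) = L f * L g := by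
    intro f g
    rw [eq_sum_mono f, eq_sum_mono g]
    simp only [Finset.sum_mul_sum, map_sum, smul_mul_smul_comm, map_smul, hL]
    refine Finset.sum_congr rfl fun X _ => Finset.sum_congr rfl fun Y _ => ?_
    rw [mono_mul, sortedProd_mul_sortedProd h0 h1]
    split_ifs
    · rw [map_smul, hL]
    · simp
  have hone : L 1 = 1 := by rw [one_def, hL]; simp [sortedProd]
  refine ⟨AlgHom.ofLinearMap L hone hmul, fun i => ?_, fun ψ hψ => ?_⟩
  · change L (mono β {i}) = _
    rw [hL]
    simp [sortedProd]
  · have hψL : ∀ X, ψ (mono β X) = L (mono β X) := fun X => by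
      rw [mono_eq_prod, ← mono_eq_prod, hL, mono_eq_prod, sortedProd, sortedProd, map_list_prod,
        List.map_map]
      congr 2
      funext i
      exact hψ i
    refine AlgHom.ext fun f => ?_
    change ψ f = L f
    rw [eq_sum_mono f]
    simp only [map_sum, map_smul, hψL]

/-- The `χ`-boundary of the monomial `e_X`, `X = {i_1 < ⋯ < i_m}`: it is
`∑ p, (-1) ^ p χ(X \ i_p) e_{X \ i_p}`, except that `∂ e_i = 1`. The exponent is the position
`p` (counted from `1`) of `i` in `X`. -/
def monoBoundary (β : Fin n → Fin n → Kˣ) (χ : Finset (Fin n) → K) (X : Finset (Fin n)) : Alg β :=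
  if #X = 1 then 1
  else ∑ i ∈ X, ((-1) ^ #{j ∈ X | j ≤ i} * χ (X.erase i)) • mono β (X.erase i)

/-- The `χ`-boundary `∂`, extended linearly from the monomials. -/
def boundary (β : Fin n → Fin n → Kˣ) (χ : Finset (Fin n) → K) : Alg β →ₗ[K] Alg β :=
  Fintype.linearCombination K (monoBoundary β χ)

theorem boundary_mono (χ : Finset (Fin n) → K) (X : Finset (Fin n)) :
    boundary β χ (mono β X) = monoBoundary β χ X := by
  have := Fintype.linearCombination_apply_single K (monoBoundary β χ) X (1 : K)
  rw [one_smul] at this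
  exact this

/-- `U` contains exactly one circuit of `M`. -/
def Unidependent (M : Matroid (Fin n)) (U : Finset (Fin n)) : Prop :=
  ∃! C : Finset (Fin n), M.IsCircuit (C : Set (Fin n)) ∧ C ⊆ U

/-- The two conditions on `χ` under which the quotient by the `χ`-ideal is a `χ`-algebra. -/
structure IsChiMap (β : Fin n → Fin n → Kˣ) (M : Matroid (Fin n)) (χ : Finset (Fin n) → K) :
    Prop where
  ne_zero_iff : ∀ I : Finset (Fin n), χ I ≠ 0 ↔ M.Indep (I : Set (Fin n))
  boundary_eq : ∀ U U' : Finset (Fin n), Unidependent M U → Unidependent M U' → U' ⊆ U →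
    ∃ ε : K, ε ≠ 0 ∧
      boundary β χ (mono β U) = ε • (boundary β χ (mono β U') * mono β (U \ U'))

/-- Right ideals of the algebra, i.e. submodules over the opposite ring. -/
abbrev RightIdeal (β : Fin n → Fin n → Kˣ) : Type _ := Submodule (Alg β)ᵐᵒᵖ (Alg β)

/-- The `χ`-ideal: the right ideal generated by the boundaries of the circuits with at least two
elements and by the loops. -/
def chiIdeal (β : Fin n → Fin n → Kˣ) (M : Matroid (Fin n)) (χ : Finset (Fin n) → K) :
    RightIdeal β :=
  Submodule.span (Alg β)ᵐᵒᵖ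
    ({f | ∃ C : Finset (Fin n), M.IsCircuit (C : Set (Fin n)) ∧ 1 < #C ∧
        f = boundary β χ (mono β C)} ∪
      {f | ∃ i : Fin n, M.IsCircuit {i} ∧ f = gen β i})

end Algebra

/-- A term order on the monomials `e_X`, written on the index sets `X`: a strict total order with
`e_∅ = 1` as least element, compatible with the nonzero products. Here `e_X e_Z ≠ 0` means that
`X` and `Z` are disjoint, and then `e_X e_Z` is a nonzero multiple of the monomial `e_{X ∪ Z}`. -/
structure TermOrder (n : ℕ) where
  lt : Finset (Fin n) → Finset (Fin n) → Prop
  isStrictTotalOrder : IsStrictTotalOrder (Finset (Fin n)) lt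
  empty_lt : ∀ X : Finset (Fin n), X ≠ ∅ → lt ∅ X
  mul_lt_mul : ∀ X Y Z : Finset (Fin n), lt X Y → Disjoint X Z → Disjoint Y Z →
    lt (X ∪ Z) (Y ∪ Z)

section Groebner

variable {K : Type*} [Field K] {n : ℕ} {β : Fin n → Fin n → Kˣ}

/-- `e_X` is the largest monomial occurring in `f`. -/
def IsLeading (t : TermOrder n) (f : Alg β) (X : Finset (Fin n)) : Prop :=
  coeff f X ≠ 0 ∧ ∀ Y, coeff f Y ≠ 0 → Y ≠ X → t.lt Y X

theorem exists_isLeading (t : TermOrder n) {f : Alg β} (hf : f ≠ 0) : ∃ X, IsLeading t f X := by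
  have := t.isStrictTotalOrder
  have hne : ({X | coeff f X ≠ 0} : Set (Finset (Fin n))).Nonempty := by
    by_contra h
    rw [Set.not_nonempty_iff_eq_empty] at h
    refine hf (ext fun X => ?_)
    by_contra hX
    exact (Set.eq_empty_iff_forall_notMem.1 h X) hX
  obtain ⟨X, hX, hmax⟩ := (Finite.wellFounded_of_trans_of_irrefl (Function.swap t.lt)).has_min _ hne
  refine ⟨X, hX, fun Y hY hYX => ?_⟩
  rcases trichotomous_of t.lt Y X with h | h | h
  · exact h
  · exact absurd h hYX
  · exact absurd h (hmax Y hY)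

theorem IsLeading.unique {t : TermOrder n} {f : Alg β} {X Y : Finset (Fin n)}
    (hX : IsLeading t f X) (hY : IsLeading t f Y) : X = Y := by
  have := t.isStrictTotalOrder
  by_contra h
  exact asymm_of t.lt (hY.2 X hX.1 h) (hX.2 Y hY.1 (Ne.symm h))

open Classical in
/-- The leading monomial of `f`, with value `0` at `f = 0`. -/
noncomputable def leadingMonomial (t : TermOrder n) (f : Alg β) : Alg β :=
  if h : f = 0 then 0 else mono β (exists_isLeading t h).choose

/-- The leading term ideal of `S`, generated by the leading monomials of the elements of `S`.
(An ideal generated by monomials is the same thing whether left, right or two-sided.) -/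
noncomputable def leadingIdeal (t : TermOrder n) (S : Set (Alg β)) : RightIdeal β :=
  Submodule.span (Alg β)ᵐᵒᵖ (leadingMonomial t '' S)

/-- `G` is a Gröbner basis of `J` with respect to the term order `t`. -/
def IsGroebnerBasis (t : TermOrder n) (J : RightIdeal β) (G : Set (Alg β)) : Prop :=
  G ⊆ (J : Set (Alg β)) ∧ (0 : Alg β) ∉ G ∧ leadingIdeal t G = leadingIdeal t (J : Set (Alg β))

/-- `G` is a Gröbner basis of `J` with respect to all term orders simultaneously. -/
def IsUniversalGroebnerBasis (J : RightIdeal β) (G : Set (Alg β)) : Prop :=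
  ∀ t : TermOrder n, IsGroebnerBasis t J G

/-- `G` is a universal Gröbner basis of `J`, minimal for inclusion with this property. -/
def IsMinimalUniversalGroebnerBasis (J : RightIdeal β) (G : Set (Alg β)) : Prop :=
  Minimal (IsUniversalGroebnerBasis J) G

end Groebner

end ChiAlgebra

/-! For a circuit `C`, the coefficients of the boundary of `e_C` at the monomials `e_{C \ c}` are
nonzero, since each `C \ c` is independent. Its leading monomial is therefore the broken circuit `C
\ a`, with `a` the smallest element of `C` for the order of the generators (`isLeading_boundary`).
The Gröbner property thus amounts to this: no leading monomial `e_X` of an element `f` of the ideal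
has `X` free of broken circuits.

Such an `X` is excluded by a linear functional that kills the ideal but not `f`. The set `X` is
independent, and its final segments span a flag of flats; `level` records where an element leaves
this flag. The functional is supported on the independent sets that have one element on each level
occurring in `X`. Its weight is a sorting sign times the inverse of `χ`, so that on a boundary the
values of `χ` cancel and only signs remain. Every circuit attains its lowest level at least twice,
so in the boundary of a set containing a circuit at most two terms survive, with opposite signs
(`levelFunctional_boundary`). Condition (2) on `χ` transfers this to right multiples, hence to the
ideal (`levelFunctional_chiIdeal`). On the other hand `X` is the smallest set in the support
(`eq_or_lt_of_isTransversal`), while `f` has no monomial above `e_X`; so the value at `f` is a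
single nonzero term.

For minimality, take a term order in which the elements of `C` come before all others. Then no other
broken circuit divides `C \ a`, so the boundary of `e_C` cannot be omitted. -/

namespace ChiAlgebra

/-! ### Sorting signs and their cancellation. -/

section LevelSign

variable {n : ℕ}

/-- The sign of the permutation that sorts `Y` by increasing level. -/
def levelSign (R : Type*) [CommRing R] (lev : Fin n → ℕ) (Y : Finset (Fin n)) : R :=
  ∏ x ∈ Y, ∏ y ∈ Y, if x < y ∧ ¬ lev x < lev y then -1 else 1

theorem levelSign_ne_zero {K : Type*} [Field K] (lev : Fin n → ℕ) (Y : Finset (Fin n)) :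
    levelSign K lev Y ≠ 0 := by
  simp only [levelSign, Finset.prod_ne_zero_iff]
  intro x _ y _
  split_ifs <;> simp

variable {R : Type*} [CommRing R]

theorem levelSign_insert {lev : Fin n → ℕ} {Y : Finset (Fin n)} {a : Fin n}
    (h : ∀ x ∈ Y, lev x ≠ lev a) :
    levelSign R lev (insert a Y) =
      (∏ x ∈ Y, if x < a ↔ lev x < lev a then 1 else -1) * levelSign R lev Y := by
  have ha : a ∉ Y := fun hY => h a hY rfl
  simp only [levelSign, Finset.prod_insert ha, Finset.prod_mul_distrib, lt_self_iff_false,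
    false_and, if_false, one_mul]
  rw [← mul_assoc, ← Finset.prod_mul_distrib]
  congr 1
  refine Finset.prod_congr rfl fun x hx => ?_
  have hne := h x hx
  have hxa : x ≠ a := fun e => ha (e ▸ hx)
  rcases lt_or_gt_of_ne hxa with h1 | h1 <;> rcases lt_or_gt_of_ne hne with h2 | h2 <;>
    simp [h1, h2, h1.not_gt, h2.not_gt]

theorem neg_one_pow_card_filter (U : Finset (Fin n)) (p : Fin n → Prop) [DecidablePred p] :
    (-1 : R) ^ #{x ∈ U | p x} = ∏ x ∈ U, if p x then -1 else 1 := by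
  rw [Finset.prod_ite, Finset.prod_const, Finset.prod_const_one, mul_one]

/-- This is the sign cancellation between the two surviving terms of a boundary. Each `x` in `Y`
contributes the same total sign to both: an `x` between `a` and `b` changes the position parity and
the inversion count simultaneously. The two terms differ only because `a` itself is counted in the
position of `b`. -/
theorem position_mul_levelSign {lev : Fin n → ℕ} {Y : Finset (Fin n)} {a b : Fin n} (hab : a < b)
    (hlev : lev a = lev b) (h : ∀ x ∈ Y, lev x ≠ lev a) :
    (-1) ^ #{x ∈ insert a (insert b Y) | x ≤ a} * levelSign R lev (insert b Y) +
      (-1) ^ #{x ∈ insert a (insert b Y) | x ≤ b} * levelSign R lev (insert a Y) = 0 := by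
  have hb : b ∉ Y := fun hY => h b hY hlev.symm
  have ha : a ∉ insert b Y := by
    simpa [hab.ne] using fun hY => h a hY rfl
  have key : (∏ x ∈ Y, if x ≤ a then (-1 : R) else 1) *
        (∏ x ∈ Y, if x < b ↔ lev x < lev b then 1 else -1) =
      (∏ x ∈ Y, if x ≤ b then (-1 : R) else 1) *
        (∏ x ∈ Y, if x < a ↔ lev x < lev a then 1 else -1) := by
    rw [← Finset.prod_mul_distrib, ← Finset.prod_mul_distrib]
    refine Finset.prod_congr rfl fun x hx => ?_
    have hxa : x ≠ a := fun e => ha (Finset.mem_insert_of_mem (e ▸ hx))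
    have hxb : x ≠ b := fun e => hb (e ▸ hx)
    rw [hlev]
    simp only [le_iff_lt_or_eq, hxa, hxb, or_false]
    by_cases h1 : x < a <;> by_cases h2 : x < b <;> by_cases h3 : lev x < lev b <;>
      simp [h1, h2, h3]
  rw [levelSign_insert h, levelSign_insert fun x hx => hlev ▸ h x hx, neg_one_pow_card_filter,
    neg_one_pow_card_filter, Finset.prod_insert ha, Finset.prod_insert ha, Finset.prod_insert hb,
    Finset.prod_insert hb]
  simp only [le_refl, if_true, hab.not_ge, if_false, hab.le]
  linear_combination (-levelSign R lev Y) * key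

end LevelSign

/-! ### A linear functional that vanishes on the `χ`-ideal. -/

section Functional

variable {K : Type*} [Field K] {n : ℕ} {β : Fin n → Fin n → Kˣ} {M : Matroid (Fin n)}
  {χ : Finset (Fin n) → K} {lev : Fin n → ℕ} {T : Finset ℕ}

/-- `Y` is independent and has exactly one element on every level in `T`, and no others. -/
def IsTransversal (M : Matroid (Fin n)) (lev : Fin n → ℕ) (T : Finset ℕ) (Y : Finset (Fin n)) :
    Prop :=
  M.Indep (Y : Set (Fin n)) ∧ Set.InjOn lev Y ∧ Y.image lev = T

open Classical in
/-- The value of `levelFunctional` on the monomial `e_Y`. -/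
noncomputable def levelWeight (M : Matroid (Fin n)) (χ : Finset (Fin n) → K) (lev : Fin n → ℕ)
    (T : Finset ℕ) (Y : Finset (Fin n)) : K :=
  if IsTransversal M lev T Y then levelSign K lev Y * (χ Y)⁻¹ else 0

/-- The iterated residue along the flag given by a level function. -/
noncomputable def levelFunctional (β : Fin n → Fin n → Kˣ) (M : Matroid (Fin n))
    (χ : Finset (Fin n) → K) (lev : Fin n → ℕ) (T : Finset ℕ) : Alg β →ₗ[K] K :=
  Fintype.linearCombination K (levelWeight M χ lev T)

theorem levelFunctional_apply (f : Alg β) :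
    levelFunctional β M χ lev T f = ∑ Y, coeff f Y * levelWeight M χ lev T Y :=
  Fintype.linearCombination_apply K _ _

theorem levelFunctional_mono (X : Finset (Fin n)) :
    levelFunctional β M χ lev T (mono β X) = levelWeight M χ lev T X := by
  simp [levelFunctional_apply, coeff_mono]

theorem levelWeight_eq_zero {Y : Finset (Fin n)} (h : ¬ IsTransversal M lev T Y) :
    levelWeight M χ lev T Y = 0 := if_neg h

theorem levelWeight_ne_zero_iff (hχ : IsChiMap β M χ) {Y : Finset (Fin n)} :
    levelWeight M χ lev T Y ≠ 0 ↔ IsTransversal M lev T Y := by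
  by_cases h : IsTransversal M lev T Y
  · simp [levelWeight, h, levelSign_ne_zero, (hχ.ne_zero_iff Y).2 h.1]
  · simp [levelWeight, h]

theorem chi_mul_levelWeight (hχ : IsChiMap β M χ) {Y : Finset (Fin n)}
    (h : IsTransversal M lev T Y) : χ Y * levelWeight M χ lev T Y = levelSign K lev Y := by
  rw [levelWeight, if_pos h, mul_left_comm, mul_inv_cancel₀ ((hχ.ne_zero_iff Y).2 h.1), mul_one]

/-- If `U \ a` is independent, every circuit in `U` is the fundamental circuit of `a`, hence equals
`C`; deleting any element of `C` destroys it. -/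
theorem indep_erase_of_isCircuit {U C : Finset (Fin n)} (hC : M.IsCircuit (C : Set (Fin n)))
    (hCU : C ⊆ U) (hE : M.E = Set.univ) {a b : Fin n}
    (ha : M.Indep (U.erase a : Finset (Fin n))) (hb : b ∈ C) :
    M.Indep (U.erase b : Finset (Fin n)) := by
  have hsub : ∀ D : Set (Fin n), D ⊆ U → D ⊆ insert a (U.erase a : Finset (Fin n)) := by
    intro D hD x hx
    by_cases hxa : x = a
    · exact Or.inl hxa
    · exact Or.inr (by simpa [hxa] using hD hx)
  rw [Matroid.indep_iff_forall_subset_not_isCircuit (by simp [hE])]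
  intro D hD hDc
  have h1 := hDc.eq_fundCircuit_of_subset ha
    (hsub D (hD.trans (by simp)))
  have h2 := hC.eq_fundCircuit_of_subset ha (hsub C (by exact_mod_cast hCU))
  have : b ∈ D := by rw [h1, ← h2]; exact hb
  simpa using hD this

/-- By `hlev` the circuit has two elements on its lowest level, and a transversal `U \ i` must omit
one of them. The two remaining terms are transversal together or not at all, and they cancel by
`position_mul_levelSign`. -/
theorem levelFunctional_boundary (hχ : IsChiMap β M χ) (hE : M.E = Set.univ)
    (hlev : ∀ C : Finset (Fin n), M.IsCircuit (C : Set (Fin n)) →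
      ∀ c ∈ C, ∃ c' ∈ C, c' ≠ c ∧ lev c' ≤ lev c)
    {U C : Finset (Fin n)} (hC : M.IsCircuit (C : Set (Fin n))) (hCU : C ⊆ U) :
    levelFunctional β M χ lev T (boundary β χ (mono β U)) = 0 := by
  obtain ⟨m, hmC, hmin⟩ := C.exists_min_image lev (by exact_mod_cast hC.nonempty)
  obtain ⟨m', hmC', hmm', hle⟩ := hlev C hC m hmC
  -- The exceptional value of the boundary on singletons does not occur, as `U` contains `m` and
  -- `m'`.
  have hU1 : #U ≠ 1 := fun h => by
    obtain ⟨u, rfl⟩ := Finset.card_eq_one.1 h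
    have h1 := Finset.mem_singleton.1 (hCU hmC)
    have h2 := Finset.mem_singleton.1 (hCU hmC')
    exact hmm' (h2.trans h1.symm)
  rw [boundary_mono, monoBoundary, if_neg hU1]
  simp only [map_sum, map_smul, smul_eq_mul, levelFunctional_mono, mul_assoc]
  have heq : lev m' = lev m := le_antisymm hle (hmin m' hmC')
  have hmem : ∀ i ∈ U, IsTransversal M lev T (U.erase i) → i = m ∨ i = m' := by
    intro i hi hT
    by_contra! hne
    exact hmm' (hT.2.1 (by simpa using ⟨hCU hmC', hne.2.symm⟩)
      (by simpa using ⟨hCU hmC, hne.1.symm⟩) heq)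
  obtain ⟨a, b, hab, haC, hbC, hl, hset⟩ : ∃ a b, a < b ∧ a ∈ C ∧ b ∈ C ∧ lev a = lev b ∧
      ∀ i ∈ U, IsTransversal M lev T (U.erase i) → i = a ∨ i = b := by
    rcases lt_or_gt_of_ne hmm' with h | h
    · exact ⟨m', m, h, hmC', hmC, heq, fun i hi hT => (hmem i hi hT).symm⟩
    · exact ⟨m, m', h, hmC, hmC', heq.symm, hmem⟩
  have haU := hCU haC
  have hbU := hCU hbC
  set Y := (U.erase a).erase b with hY
  have hbY : insert b Y = U.erase a := Finset.insert_erase (by simp [hbU, hab.ne'])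
  have haY : insert a Y = U.erase b := by
    rw [hY, Finset.erase_right_comm]
    exact Finset.insert_erase (by simp [haU, hab.ne])
  have hUY : insert a (insert b Y) = U := by rw [hbY, Finset.insert_erase haU]
  have hiff : IsTransversal M lev T (U.erase a) ↔ IsTransversal M lev T (U.erase b) := by
    have hind : M.Indep (U.erase a : Finset (Fin n)) ↔ M.Indep (U.erase b : Finset (Fin n)) :=
      ⟨fun h => indep_erase_of_isCircuit hC hCU hE h hbC,
        fun h => indep_erase_of_isCircuit hC hCU hE h haC⟩
    have hbn : b ∉ (Y : Set (Fin n)) := by simp [hY]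
    have han : a ∉ (Y : Set (Fin n)) := by simp [hY]
    rw [IsTransversal, IsTransversal, hind, ← hbY, ← haY, Finset.coe_insert, Finset.coe_insert,
      Set.injOn_insert hbn, Set.injOn_insert han, Finset.image_insert, Finset.image_insert, hl]
  by_cases hT : IsTransversal M lev T (U.erase a)
  · rw [Finset.sum_eq_add a b hab.ne]
    · rw [chi_mul_levelWeight hχ hT, chi_mul_levelWeight hχ (hiff.1 hT)]
      have := position_mul_levelSign (R := K) (Y := Y) hab hl (fun x hx he => by
        have h1 : x = b := by
          refine hT.2.1 (by rw [← hbY]; simp [hx]) (by simp [hbU, hab.ne']) (he.trans hl)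
        simp [hY, h1] at hx)
      rwa [hUY, hbY, haY] at this
    · intro i hi hne
      rw [levelWeight_eq_zero, mul_zero, mul_zero]
      intro h
      rcases hset i hi h with h | h
      · exact hne.1 h
      · exact hne.2 h
    · exact fun h => absurd haU h
    · exact fun h => absurd hbU h
  · refine Finset.sum_eq_zero fun i hi => ?_
    rw [levelWeight_eq_zero, mul_zero, mul_zero]
    intro h
    rcases hset i hi h with rfl | rfl
    · exact hT h
    · exact hT (hiff.2 h)

theorem unidependent_of_isCircuit {C : Finset (Fin n)} (hC : M.IsCircuit (C : Set (Fin n))) :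
    Unidependent M C :=
  ⟨C, ⟨hC, subset_rfl⟩, fun D hD => by
    exact_mod_cast (hC.eq_of_superset_isCircuit hD.1 (by exact_mod_cast hD.2)).symm⟩

theorem one_lt_card_of_isCircuit (hloop : M.Loopless) {C : Finset (Fin n)}
    (hC : M.IsCircuit (C : Set (Fin n))) : 1 < #C :=
  Finset.one_lt_card_iff_nontrivial.2 (Matroid.loopless_iff_forall_isCircuit.1 hloop _ hC)

theorem boundary_mono_of_isCircuit (hloop : M.Loopless) {C : Finset (Fin n)}
    (hC : M.IsCircuit (C : Set (Fin n))) :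
    boundary β χ (mono β C) =
      ∑ i ∈ C, ((-1) ^ #{j ∈ C | j ≤ i} * χ (C.erase i)) • mono β (C.erase i) := by
  rw [boundary_mono, monoBoundary, if_neg (one_lt_card_of_isCircuit hloop hC).ne']

theorem levelFunctional_boundary_mul_mono (hχ : IsChiMap β M χ) (hE : M.E = Set.univ)
    (hloop : M.Loopless)
    (hlev : ∀ C : Finset (Fin n), M.IsCircuit (C : Set (Fin n)) →
      ∀ c ∈ C, ∃ c' ∈ C, c' ≠ c ∧ lev c' ≤ lev c)
    {C : Finset (Fin n)} (hC : M.IsCircuit (C : Set (Fin n))) (Z : Finset (Fin n)) :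
    levelFunctional β M χ lev T (boundary β χ (mono β C) * mono β Z) = 0 := by
  -- In the first case condition (2) makes the product a nonzero multiple of the boundary of `e_{C ∪
  -- Z}`. Otherwise every term has weight zero: if some `(C \ i) ∪ Z` with disjoint parts were
  -- independent, then `i` would lie outside `Z` and `C` would be the only circuit in `C ∪ Z`.
  by_cases h : Disjoint C Z ∧ Unidependent M (C ∪ Z)
  · obtain ⟨ε, hε, he⟩ := hχ.boundary_eq (C ∪ Z) C h.2 (unidependent_of_isCircuit hC)
      Finset.subset_union_left
    have h0 := levelFunctional_boundary (T := T) hχ hE hlev hC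
      (Finset.subset_union_left (s₂ := Z))
    rw [he, Finset.union_sdiff_cancel_left h.1, map_smul, smul_eq_mul] at h0
    exact (mul_eq_zero.1 h0).resolve_left hε
  · rw [boundary_mono_of_isCircuit hloop hC, Finset.sum_mul, map_sum]
    refine Finset.sum_eq_zero fun i hi => ?_
    rw [smul_mul_assoc, map_smul, mono_mul]
    split_ifs with hd
    · rw [map_smul, levelFunctional_mono, levelWeight_eq_zero, smul_zero, smul_zero]
      rintro ⟨hind, -⟩
      have hsub : C ⊆ insert i (C.erase i ∪ Z) := by
        intro x hx
        by_cases hxi : x = i <;> simp [hxi, hx]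
      have hCf := hC.eq_fundCircuit_of_subset hind (by exact_mod_cast hsub)
      by_cases hiZ : i ∈ Z
      · rw [Finset.insert_eq_of_mem (by simp [hiZ])] at hsub
        exact hC.not_indep (hind.subset (by exact_mod_cast hsub))
      · refine h ⟨?_, C, ⟨hC, Finset.subset_union_left⟩, fun D ⟨hD, hDU⟩ => ?_⟩
        · rw [← Finset.insert_erase hi, Finset.disjoint_insert_left]
          exact ⟨hiZ, hd⟩
        · have hDs : D ⊆ insert i (C.erase i ∪ Z) := by
            rwa [← Finset.insert_union, Finset.insert_erase hi]
          have := (hD.eq_fundCircuit_of_subset hind (by exact_mod_cast hDs)).trans hCf.symm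
          exact_mod_cast this
    · simp

theorem levelFunctional_chiIdeal (hχ : IsChiMap β M χ) (hE : M.E = Set.univ)
    (hloop : M.Loopless)
    (hlev : ∀ C : Finset (Fin n), M.IsCircuit (C : Set (Fin n)) →
      ∀ c ∈ C, ∃ c' ∈ C, c' ≠ c ∧ lev c' ≤ lev c)
    {f : Alg β} (hf : f ∈ chiIdeal β M χ) : levelFunctional β M χ lev T f = 0 := by
  -- The functional is only `K`-linear, so the statement is strengthened to all right multiples to
  -- survive induction over a right ideal.
  suffices h : ∀ g, levelFunctional β M χ lev T (f * g) = 0 by simpa using h 1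
  induction hf using Submodule.span_induction with
  | mem f hf =>
    intro g
    rcases hf with ⟨C, hC, -, rfl⟩ | ⟨i, hi, -⟩
    · rw [eq_sum_mono g, Finset.mul_sum, map_sum]
      refine Finset.sum_eq_zero fun Z _ => ?_
      rw [mul_smul_comm, map_smul, levelFunctional_boundary_mul_mono hχ hE hloop hlev hC,
        smul_zero]
    · exact absurd (Matroid.loopless_iff_forall_isCircuit.1 hloop _ hi) (by simp)
  | zero => simp
  | add f g _ _ hf hg => intro k; rw [add_mul, map_add, hf, hg, add_zero]
  | smul a f _ hf => intro g; rw [← MulOpposite.op_unop a, op_smul_eq_mul, mul_assoc, hf]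

end Functional

/-! ### Term orders and the induced order of the generators. -/

section TermOrder

variable {n : ℕ}

theorem TermOrder.trans (t : TermOrder n) {X Y Z : Finset (Fin n)} (h : t.lt X Y) (h' : t.lt Y Z) :
    t.lt X Z :=
  have := t.isStrictTotalOrder
  trans_of t.lt h h'

theorem TermOrder.irrefl (t : TermOrder n) (X : Finset (Fin n)) : ¬ t.lt X X :=
  have := t.isStrictTotalOrder
  irrefl_of t.lt X

theorem TermOrder.trichotomous (t : TermOrder n) (X Y : Finset (Fin n)) :
    t.lt X Y ∨ X = Y ∨ t.lt Y X :=
  have := t.isStrictTotalOrder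
  trichotomous_of t.lt X Y

open Classical in
/-- The position of `e_a` among the generators. -/
noncomputable def TermOrder.rank (t : TermOrder n) (a : Fin n) : ℕ := #{j | t.lt {j} {a}}

theorem TermOrder.rank_lt_of_lt (t : TermOrder n) {a b : Fin n} (h : t.lt {a} {b}) :
    t.rank a < t.rank b := by
  refine Finset.card_lt_card (Finset.ssubset_iff_of_subset ?_ |>.2 ⟨a, ?_, ?_⟩)
  · intro j hj
    simp only [Finset.mem_filter, Finset.mem_univ, true_and] at hj ⊢
    exact t.trans hj h
  · simpa using h
  · simpa using t.irrefl {a}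

theorem TermOrder.rank_injective (t : TermOrder n) : Function.Injective t.rank := by
  intro a b h
  rcases t.trichotomous {a} {b} with h1 | h1 | h1
  · exact absurd h (t.rank_lt_of_lt h1).ne
  · simpa using h1
  · exact absurd h (t.rank_lt_of_lt h1).ne'

theorem TermOrder.rank_lt_iff (t : TermOrder n) {a b : Fin n} :
    t.rank a < t.rank b ↔ t.lt {a} {b} := by
  refine ⟨fun h => ?_, t.rank_lt_of_lt⟩
  rcases t.trichotomous {a} {b} with h1 | h1 | h1
  · exact h1
  · rw [Finset.singleton_injective h1] at h
    exact absurd h (lt_irrefl _)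
  · exact absurd (t.rank_lt_of_lt h1) h.not_gt

theorem TermOrder.insert_lt_insert (t : TermOrder n) {X Y : Finset (Fin n)} {a : Fin n}
    (h : t.lt X Y) (hX : a ∉ X) (hY : a ∉ Y) : t.lt (insert a X) (insert a Y) := by
  have := t.mul_lt_mul X Y {a} h (by simpa using hX) (by simpa using hY)
  rwa [Finset.union_comm, ← Finset.insert_eq, Finset.union_comm, ← Finset.insert_eq] at this

theorem TermOrder.insert_lt_insert_of_lt (t : TermOrder n) {X : Finset (Fin n)} {a b : Fin n}
    (h : t.lt {a} {b}) (ha : a ∉ X) (hb : b ∉ X) : t.lt (insert a X) (insert b X) :=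
  t.mul_lt_mul {a} {b} X h (by simpa using ha) (by simpa using hb)

/-- Elements of `Y` are exchanged one at a time for smaller ones. Injectivity, and the requirement
that a moved element lands outside `Y`, keep every intermediate product nonzero, so that
multiplicativity of the order applies. -/
theorem TermOrder.image_eq_or_lt (t : TermOrder n) (φ : Fin n → Fin n) (Y : Finset (Fin n))
    (hinj : Set.InjOn φ Y) (h : ∀ y ∈ Y, φ y = y ∨ φ y ∉ Y ∧ t.lt {φ y} {y}) :
    Y.image φ = Y ∨ t.lt (Y.image φ) Y := by
  induction Y using Finset.induction_on with
  | empty => simp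
  | insert y Y hy ih =>
    have ih := ih (hinj.mono (by simp)) fun z hz => by
      rcases h z (Finset.mem_insert_of_mem hz) with h | h
      · exact Or.inl h
      · exact Or.inr ⟨fun h' => h.1 (Finset.mem_insert_of_mem h'), h.2⟩
    have h1 : φ y ∉ Y.image φ := by
      rw [Finset.mem_image]
      rintro ⟨z, hz, he⟩
      have : z = y := hinj (by simp [hz]) (by simp) he
      exact hy (this ▸ hz)
    have h2 : φ y ∉ Y := by
      rcases h y (Finset.mem_insert_self _ _) with h | h
      · rwa [h]
      · exact fun h' => h.1 (Finset.mem_insert_of_mem h')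
    have h3 : insert (φ y) (Y.image φ) = insert (φ y) Y ∨
        t.lt (insert (φ y) (Y.image φ)) (insert (φ y) Y) :=
      ih.imp (fun e => by rw [e]) fun e => t.insert_lt_insert e h1 h2
    rw [Finset.image_insert]
    rcases h y (Finset.mem_insert_self _ _) with h4 | h4
    · rw [h4] at h3 ⊢
      exact h3
    · have h5 := t.insert_lt_insert_of_lt h4.2 h2 hy
      rcases h3 with h3 | h3
      · exact Or.inr (h3 ▸ h5)
      · exact Or.inr (t.trans h3 h5)

end TermOrder

/-! ### Levels along the flag of `X`, and broken circuits. -/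

section Level

variable {n : ℕ} {M : Matroid (Fin n)} {r : Fin n → ℕ} {X : Finset (Fin n)}

/-- The first step at which `e` leaves the flag of flats spanned by the final segments of `X`
for the ranking `r`. -/
noncomputable def level (M : Matroid (Fin n)) (r : Fin n → ℕ) (X : Finset (Fin n)) (e : Fin n) :
    ℕ :=
  sInf {k | e ∉ M.closure {x | x ∈ X ∧ k ≤ r x}}

theorem notMem_closure_level (hloop : M.Loopless) (e : Fin n) :
    e ∉ M.closure {x | x ∈ X ∧ level M r X e ≤ r x} := by
  -- Beyond the largest rank the segment is empty and its closure consists of loops, of which there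
  -- are none. Hence the infimum is attained and is not the default value of `sInf`.
  refine Nat.sInf_mem (s := {k | e ∉ M.closure {x | x ∈ X ∧ k ≤ r x}}) ⟨X.sup r + 1, ?_⟩
  have : {x | x ∈ X ∧ X.sup r + 1 ≤ r x} = (∅ : Set (Fin n)) := by
    ext x
    simp only [Set.mem_ofPred_eq, Set.mem_empty_iff_false, iff_false, not_and, not_le]
    exact fun hx => Nat.lt_succ_of_le (Finset.le_sup hx)
  rw [Set.mem_ofPred_eq, this]
  have := M.loops_eq_empty
  rw [Matroid.loops] at this
  simp [this]

theorem mem_closure_of_lt_level {e : Fin n} {k : ℕ} (h : k < level M r X e) :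
    e ∈ M.closure {x | x ∈ X ∧ k ≤ r x} :=
  not_not.1 (Nat.notMem_of_lt_sInf h)

/-- If all other elements of `C` had a larger level, they would lie in the flat of index `level M r
X c`, and so would `c`, which is in their closure. -/
theorem exists_ne_level_le (hloop : M.Loopless) {C : Finset (Fin n)}
    (hC : M.IsCircuit (C : Set (Fin n))) {c : Fin n} (hc : c ∈ C) :
    ∃ c' ∈ C, c' ≠ c ∧ level M r X c' ≤ level M r X c := by
  by_contra! h
  refine notMem_closure_level (r := r) (X := X) hloop c ?_
  refine M.closure_subset_closure_of_subset_closure ?_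
    (hC.mem_closure_sdiff_singleton_of_mem (by exact_mod_cast hc))
  rintro x ⟨hx, hxc⟩
  exact mem_closure_of_lt_level (h x (by exact_mod_cast hx) hxc)

theorem level_of_mem (hloop : M.Loopless)
    (hX : M.Indep (X : Set (Fin n))) {x : Fin n} (hx : x ∈ X) : level M r X x = r x + 1 := by
  refine le_antisymm (Nat.sInf_le ?_) (Nat.lt_of_not_le fun h => ?_)
  · intro h
    refine hX.notMem_closure_sdiff_of_mem (by exact_mod_cast hx)
      (M.closure_subset_closure ?_ h)
    rintro y ⟨hy, hyx⟩
    refine ⟨by exact_mod_cast hy, ?_⟩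
    rintro rfl
    omega
  · exact notMem_closure_level (r := r) (X := X) hloop x
      (M.mem_closure_of_mem ⟨hx, h⟩ fun y hy => hX.subset_ground (by exact_mod_cast hy.1))

/-- `X` contains no broken circuit: no circuit deprived of its `r`-smallest element. -/
def NoBrokenCircuit (M : Matroid (Fin n)) (r : Fin n → ℕ) (X : Finset (Fin n)) : Prop :=
  ∀ C : Finset (Fin n), M.IsCircuit (C : Set (Fin n)) →
    ∀ a ∈ C, (∀ c ∈ C, c ≠ a → r a < r c) → ¬ C.erase a ⊆ X

theorem exists_rank_min (hr : Function.Injective r) {C : Finset (Fin n)} (hC : C.Nonempty) :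
    ∃ a ∈ C, ∀ c ∈ C, c ≠ a → r a < r c := by
  obtain ⟨a, ha, hmin⟩ := C.exists_min_image r hC
  exact ⟨a, ha, fun c hc hca => lt_of_le_of_ne (hmin c hc) fun h => hca (hr h).symm⟩

theorem NoBrokenCircuit.indep (h : NoBrokenCircuit M r X) (hr : Function.Injective r)
    (hE : M.E = Set.univ) : M.Indep (X : Set (Fin n)) := by
  rw [Matroid.indep_iff_forall_subset_not_isCircuit (by simp [hE])]
  intro C hCX hC
  lift C to Finset (Fin n) using C.toFinite
  obtain ⟨a, ha, hmin⟩ := exists_rank_min hr (by exact_mod_cast hC.nonempty)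
  exact h C hC a ha hmin ((Finset.erase_subset _ _).trans (by exact_mod_cast hCX))

/-- The absence of broken circuits enters here: an element `y` on the level of `x` but of smaller
rank would close up a circuit with elements of `X` of rank at least `r x`, and `y` would be its
smallest element. -/
theorem NoBrokenCircuit.le_of_level_eq (h : NoBrokenCircuit M r X) (hr : Function.Injective r)
    (hE : M.E = Set.univ) (hloop : M.Loopless) {x y : Fin n} (hx : x ∈ X)
    (hxy : level M r X x = level M r X y) : r x ≤ r y := by
  rw [level_of_mem hloop (h.indep hr hE) hx] at hxy
  by_contra! hlt
  -- The common level is `r x + 1`, so `y` still lies in the flat of index `r x`.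
  have hcl := mem_closure_of_lt_level (M := M) (r := r) (X := X) (e := y) (k := r x) (by omega)
  obtain ⟨C, hCs, hC, hyC⟩ := Matroid.exists_isCircuit_of_mem_closure hcl
    fun hy => absurd hy.2 hlt.not_ge
  lift C to Finset (Fin n) using C.toFinite
  have hmem : ∀ c ∈ C, c ≠ y → c ∈ X ∧ r x ≤ r c := fun c hc hcy =>
    (hCs (by exact_mod_cast hc)).resolve_left hcy
  refine h C hC y (by exact_mod_cast hyC) (fun c hc hcy => hlt.trans_le (hmem c hc hcy).2) ?_
  intro c hc
  rw [Finset.mem_erase] at hc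
  exact (hmem c hc.2 hc.1).1

theorem injOn_level (hr : Function.Injective r) (hloop : M.Loopless)
    (hX : M.Indep (X : Set (Fin n))) : Set.InjOn (level M r X) X := by
  intro x hx y hy hxy
  rw [level_of_mem hloop hX (by exact_mod_cast hx),
    level_of_mem hloop hX (by exact_mod_cast hy)] at hxy
  exact hr (Nat.succ_injective hxy)

/-- Matching each `y` in `Y` with the element of `X` on its level never increases the rank, and
turns `Y` into `X`. -/
theorem eq_or_lt_of_isTransversal {t : TermOrder n} (h : NoBrokenCircuit M t.rank X)
    (hE : M.E = Set.univ) (hloop : M.Loopless) {Y : Finset (Fin n)}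
    (hY : IsTransversal M (level M t.rank X) (X.image (level M t.rank X)) Y) :
    X = Y ∨ t.lt X Y := by
  have hr := t.rank_injective
  have hinjX := injOn_level hr hloop (h.indep hr hE)
  obtain ⟨-, hinjY, himg⟩ := hY
  have hex : ∀ y ∈ Y, ∃ x ∈ X, level M t.rank X x = level M t.rank X y := fun y hy => by
    rw [← Finset.mem_image, ← himg]
    exact Finset.mem_image_of_mem _ hy
  choose! φ hφX hφ using hex
  have hXY : Y.image φ = X := by
    ext x
    rw [Finset.mem_image]
    constructor
    · rintro ⟨y, hy, rfl⟩
      exact hφX y hy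
    · intro hx
      have := Finset.mem_image_of_mem (level M t.rank X) hx
      rw [← himg, Finset.mem_image] at this
      obtain ⟨y, hy, he⟩ := this
      exact ⟨y, hy, hinjX (hφX y hy) hx ((hφ y hy).trans he)⟩
  rw [← hXY]
  refine t.image_eq_or_lt φ Y (fun y hy z hz hyz => hinjY hy hz ?_) fun y hy => ?_
  · rw [← hφ y hy, ← hφ z hz, hyz]
  · by_cases hne : φ y = y
    · exact Or.inl hne
    · refine Or.inr ⟨fun hY' => hne (hinjY hY' hy (hφ y hy)), t.rank_lt_iff.1 ?_⟩
      exact lt_of_le_of_ne (h.le_of_level_eq hr hE hloop (hφX y hy) (hφ y hy)) (hr.ne hne)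

end Level

/-! ### Leading monomials and the Gröbner property. -/

section Groebner

variable {K : Type*} [Field K] {n : ℕ} {β : Fin n → Fin n → Kˣ} {M : Matroid (Fin n)}
  {χ : Finset (Fin n) → K}

theorem coeff_sum {ι : Type*} (s : Finset ι) (f : ι → Alg β) (Y : Finset (Fin n)) :
    coeff (∑ i ∈ s, f i) Y = ∑ i ∈ s, coeff (f i) Y :=
  map_sum (AddMonoidHom.mk' (fun g : Alg β => coeff g Y) fun g h => coeff_add g h Y) f s

theorem coeff_boundary_of_isCircuit (hloop : M.Loopless) {C : Finset (Fin n)}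
    (hC : M.IsCircuit (C : Set (Fin n))) {a : Fin n} (ha : a ∈ C) :
    coeff (boundary β χ (mono β C)) (C.erase a) =
      (-1) ^ #{j ∈ C | j ≤ a} * χ (C.erase a) := by
  rw [boundary_mono_of_isCircuit hloop hC, coeff_sum, Finset.sum_eq_single a]
  · simp [coeff_smul, coeff_mono]
  · intro i hi hia
    rw [coeff_smul, coeff_mono, if_neg, mul_zero]
    exact fun h => hia ((Finset.erase_inj C ha).1 h).symm
  · exact fun h => absurd ha h

theorem exists_eq_erase_of_coeff_boundary_ne_zero (hloop : M.Loopless) {C : Finset (Fin n)}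
    (hC : M.IsCircuit (C : Set (Fin n))) {Y : Finset (Fin n)}
    (hY : coeff (boundary β χ (mono β C)) Y ≠ 0) : ∃ c ∈ C, Y = C.erase c := by
  rw [boundary_mono_of_isCircuit hloop hC, coeff_sum] at hY
  obtain ⟨c, hc, hne⟩ := Finset.exists_ne_zero_of_sum_ne_zero hY
  refine ⟨c, hc, ?_⟩
  by_contra h
  simp [coeff_smul, coeff_mono, h] at hne

/-- The sets `C \ a` and `C \ c` arise from `C \ {a, c}` by adding `c` and `a` respectively, so they
compare as the generators `e_c` and `e_a` do. -/
theorem isLeading_boundary (t : TermOrder n) (hχ : IsChiMap β M χ) (hloop : M.Loopless)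
    {C : Finset (Fin n)} (hC : M.IsCircuit (C : Set (Fin n))) {a : Fin n} (ha : a ∈ C)
    (hmin : ∀ c ∈ C, c ≠ a → t.rank a < t.rank c) :
    IsLeading t (boundary β χ (mono β C)) (C.erase a) := by
  constructor
  · rw [coeff_boundary_of_isCircuit hloop hC ha]
    refine mul_ne_zero (pow_ne_zero _ (by simp)) ((hχ.ne_zero_iff _).2 ?_)
    simpa using hC.sdiff_singleton_indep (by exact_mod_cast ha)
  · intro Y hY hne
    obtain ⟨c, hc, rfl⟩ := exists_eq_erase_of_coeff_boundary_ne_zero hloop hC hY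
    have hca : c ≠ a := fun h => hne (by rw [h])
    have h := t.insert_lt_insert_of_lt (X := (C.erase a).erase c)
      (t.rank_lt_iff.1 (hmin c hc hca)) (by simp) (by simp)
    rwa [Finset.insert_erase (by simp [hc, hca]), Finset.erase_right_comm,
      Finset.insert_erase (by simp [ha, hca.symm])] at h

theorem IsLeading.ne_zero {t : TermOrder n} {f : Alg β} {X : Finset (Fin n)}
    (h : IsLeading t f X) : f ≠ 0 := by
  rintro rfl
  exact h.1 (coeff_zero X)

theorem IsLeading.leadingMonomial_eq {t : TermOrder n} {f : Alg β} {X : Finset (Fin n)}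
    (h : IsLeading t f X) : leadingMonomial t f = mono β X := by
  rw [leadingMonomial, dif_neg h.ne_zero]
  congr 1
  exact (exists_isLeading t h.ne_zero).choose_spec.unique h

/-- The leading monomials of the elements of the `χ`-ideal contain broken circuits. -/
theorem not_noBrokenCircuit_of_isLeading (hχ : IsChiMap β M χ) (hE : M.E = Set.univ)
    (hloop : M.Loopless) {t : TermOrder n} {f : Alg β} (hf : f ∈ chiIdeal β M χ)
    {X : Finset (Fin n)} (hX : IsLeading t f X) : ¬ NoBrokenCircuit M t.rank X := by
  intro h
  have hr := t.rank_injective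
  have hind := h.indep hr hE
  have h0 := levelFunctional_chiIdeal (lev := level M t.rank X)
    (T := X.image (level M t.rank X)) hχ hE hloop
    (fun C hC c hc => exists_ne_level_le hloop hC hc) hf
  rw [levelFunctional_apply, Finset.sum_eq_single X] at h0
  · refine mul_ne_zero hX.1 ((levelWeight_ne_zero_iff hχ).2 ?_) h0
    exact ⟨hind, injOn_level hr hloop hind, rfl⟩
  · intro Y _ hYX
    by_contra hne
    have hY := (levelWeight_ne_zero_iff hχ).1 (right_ne_zero_of_mul hne)
    -- A second contributing `Y` would lie above `X` as a transversal and below it as a monomial of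
    -- `f`.
    rcases eq_or_lt_of_isTransversal h hE hloop hY with h1 | h1
    · exact hYX h1.symm
    · exact t.irrefl X (t.trans h1 (hX.2 Y (left_ne_zero_of_mul hne) hYX))
  · simp

theorem mono_mem_of_subset {J : RightIdeal β} {X Y : Finset (Fin n)} (hX : mono β X ∈ J)
    (hXY : X ⊆ Y) : mono β Y ∈ J := by
  have h : mono β Y = MulOpposite.op ((inv β X (Y \ X))⁻¹ • mono β (Y \ X)) • mono β X := by
    rw [op_smul_eq_mul, mul_smul_comm, mono_mul, if_pos Finset.disjoint_sdiff, smul_smul,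
      inv_mul_cancel₀ (inv_ne_zero _ _), one_smul, Finset.union_sdiff_of_subset hXY]
  rw [h]
  exact J.smul_mem _ hX

/-- The set of boundaries of circuits. -/
def circuitBoundaries (β : Fin n → Fin n → Kˣ) (M : Matroid (Fin n)) (χ : Finset (Fin n) → K) :
    Set (Alg β) :=
  {f | ∃ C : Finset (Fin n), M.IsCircuit (C : Set (Fin n)) ∧ f = boundary β χ (mono β C)}

theorem exists_isLeading_boundary (t : TermOrder n) (hχ : IsChiMap β M χ) (hloop : M.Loopless)
    {C : Finset (Fin n)} (hC : M.IsCircuit (C : Set (Fin n))) :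
    ∃ a ∈ C, (∀ c ∈ C, c ≠ a → t.rank a < t.rank c) ∧
      IsLeading t (boundary β χ (mono β C)) (C.erase a) := by
  obtain ⟨a, ha, hmin⟩ := exists_rank_min t.rank_injective (C := C)
    (by exact_mod_cast hC.nonempty)
  exact ⟨a, ha, hmin, isLeading_boundary t hχ hloop hC ha hmin⟩

theorem circuitBoundaries_subset_chiIdeal (hloop : M.Loopless) :
    circuitBoundaries β M χ ⊆ (chiIdeal β M χ : Set (Alg β)) := by
  rintro f ⟨C, hC, rfl⟩
  exact Submodule.subset_span (Or.inl ⟨C, hC, one_lt_card_of_isCircuit hloop hC, rfl⟩)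

theorem isGroebnerBasis_circuitBoundaries (hχ : IsChiMap β M χ) (hE : M.E = Set.univ)
    (hloop : M.Loopless) (t : TermOrder n) :
    IsGroebnerBasis t (chiIdeal β M χ) (circuitBoundaries β M χ) := by
  refine ⟨circuitBoundaries_subset_chiIdeal hloop, ?_, le_antisymm ?_ ?_⟩
  · rintro ⟨C, hC, h⟩
    obtain ⟨a, -, -, hlead⟩ := exists_isLeading_boundary t hχ hloop hC
    exact hlead.ne_zero h.symm
  · exact Submodule.span_mono (Set.image_mono (circuitBoundaries_subset_chiIdeal hloop))
  · refine Submodule.span_le.2 ?_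
    rintro _ ⟨f, hf, rfl⟩
    by_cases hf0 : f = 0
    · simp [leadingMonomial, hf0]
    obtain ⟨X, hX⟩ := exists_isLeading t hf0
    rw [hX.leadingMonomial_eq]
    have h := not_noBrokenCircuit_of_isLeading hχ hE hloop hf hX
    simp only [NoBrokenCircuit, not_forall, not_not] at h
    obtain ⟨C, hC, a, ha, hmin, hsub⟩ := h
    refine mono_mem_of_subset (Submodule.subset_span ⟨_, ⟨C, hC, rfl⟩, ?_⟩) hsub
    exact (isLeading_boundary t hχ hloop hC ha hmin).leadingMonomial_eq

/-! ### Monomial ideals, special term orders and minimality. -/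

/-- The monomials of a monomial right ideal are divisible by generators. -/
theorem exists_subset_of_mono_mem_span {S : Set (Finset (Fin n))} {Z : Finset (Fin n)}
    (h : mono β Z ∈ Submodule.span (Alg β)ᵐᵒᵖ (mono β '' S)) : ∃ X ∈ S, X ⊆ Z := by
  by_contra! hS
  -- Vanishing on all subsets of `Z`, not just at `Z`, is stable under right multiplication: a
  -- coefficient of a product at `W` involves only coefficients of the left factor at subsets of
  -- `W`.
  have key : ∀ f ∈ Submodule.span (Alg β)ᵐᵒᵖ (mono β '' S), ∀ W ⊆ Z, coeff f W = 0 := by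
    intro f hf
    induction hf using Submodule.span_induction with
    | mem f hf =>
      obtain ⟨X, hX, rfl⟩ := hf
      intro W hW
      rw [coeff_mono, if_neg]
      rintro rfl
      exact hS W hX hW
    | zero => exact fun W _ => coeff_zero W
    | add f g _ _ hf hg =>
      intro W hW
      rw [coeff_add, hf W hW, hg W hW, add_zero]
    | smul a f _ hf =>
      intro W hW
      rw [← MulOpposite.op_unop a, op_smul_eq_mul, coeff_mul]
      refine Finset.sum_eq_zero fun V hV => ?_
      rw [hf V ((Finset.mem_powerset.1 hV).trans hW), zero_mul, mul_zero]
  have := key _ h Z subset_rfl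
  simp [coeff_mono] at this

/-- The lexicographic term order attached to an injective ranking of the generators. -/
def lexOrder (r : Fin n → ℕ) (hr : Function.Injective r) : TermOrder n where
  lt X Y := ∑ i ∈ X, 2 ^ r i < ∑ i ∈ Y, 2 ^ r i
  isStrictTotalOrder :=
    { trichotomous := fun X Y h h' => by
        have he : ∑ i ∈ X, 2 ^ r i = ∑ i ∈ Y, 2 ^ r i := le_antisymm (not_lt.1 h') (not_lt.1 h)
        -- Binary expansions are unique, so equal sums come from equal sets.
        refine Finset.image_injective hr (Finset.geomSum_injective le_rfl ?_)
        simpa only [Finset.sum_image hr.injOn] using he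
      irrefl := fun X => lt_irrefl _
      trans := fun X Y Z => lt_trans }
  empty_lt X hX := by
    rw [Finset.sum_empty]
    exact Finset.sum_pos (fun _ _ => by positivity) (Finset.nonempty_iff_ne_empty.2 hX)
  mul_lt_mul X Y Z h hX hY := by
    rw [Finset.sum_union hX, Finset.sum_union hY]
    exact Nat.add_lt_add_right h _

theorem rank_lexOrder_lt_iff {r : Fin n → ℕ} (hr : Function.Injective r) {a b : Fin n} :
    (lexOrder r hr).rank a < (lexOrder r hr).rank b ↔ r a < r b := by
  rw [TermOrder.rank_lt_iff]
  change ∑ i ∈ {a}, 2 ^ r i < ∑ i ∈ {b}, 2 ^ r i ↔ _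
  rw [Finset.sum_singleton, Finset.sum_singleton]
  exact Nat.pow_lt_pow_iff_right (by norm_num)

/-- There is a term order for which the elements of a given set precede all other generators. -/
theorem exists_termOrder_rank_lt (C : Finset (Fin n)) :
    ∃ t : TermOrder n, ∀ a ∈ C, ∀ b ∉ C, t.rank a < t.rank b := by
  let r : Fin n → ℕ := fun i => if i ∈ C then i else n + i
  have hr : Function.Injective r := by
    intro i j h
    have hi := i.2
    have hj := j.2
    refine Fin.ext ?_
    simp only [r] at h
    split_ifs at h <;> omega
  refine ⟨lexOrder r hr, fun a ha b hb => (rank_lexOrder_lt_iff hr).2 ?_⟩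
  have := a.2
  simp only [r, if_pos ha, if_neg hb]
  omega

theorem circuitBoundaries_subset_of_isUniversalGroebnerBasis (hχ : IsChiMap β M χ)
    (hloop : M.Loopless) {G : Set (Alg β)}
    (hG : IsUniversalGroebnerBasis (chiIdeal β M χ) G) (hsub : G ⊆ circuitBoundaries β M χ) :
    circuitBoundaries β M χ ⊆ G := by
  rintro f ⟨C, hC, rfl⟩
  by_contra hCG
  obtain ⟨t, ht⟩ := exists_termOrder_rank_lt C
  obtain ⟨a, ha, hmin, hlead⟩ := exists_isLeading_boundary (β := β) (χ := χ) t hχ hloop hC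
  have hmem : mono β (C.erase a) ∈ leadingIdeal t G := by
    rw [(hG t).2.2, ← hlead.leadingMonomial_eq]
    exact Submodule.subset_span
      ⟨_, circuitBoundaries_subset_chiIdeal hloop ⟨C, hC, rfl⟩, rfl⟩
  have hle : leadingIdeal t G ≤ Submodule.span (Alg β)ᵐᵒᵖ (mono β '' {X | ∃ (D : Finset (Fin n)) (b : Fin n),
      M.IsCircuit (D : Set (Fin n)) ∧ D ≠ C ∧ b ∈ D ∧
        (∀ c ∈ D, c ≠ b → t.rank b < t.rank c) ∧ X = D.erase b}) := by
    refine Submodule.span_mono ?_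
    rintro _ ⟨g, hg, rfl⟩
    obtain ⟨D, hD, rfl⟩ := hsub hg
    obtain ⟨b, hb, hbmin, hblead⟩ := exists_isLeading_boundary (β := β) (χ := χ) t hχ hloop hD
    refine ⟨D.erase b, ⟨D, b, hD, ?_, hb, hbmin, rfl⟩, hblead.leadingMonomial_eq.symm⟩
    rintro rfl
    exact hCG hg
  obtain ⟨_, ⟨D, b, hD, hDC, hb, hbmin, rfl⟩, hDs⟩ := exists_subset_of_mono_mem_span (hle hmem)
  have hDs' : D.erase b ⊆ C := hDs.trans (Finset.erase_subset _ _)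
  -- If `b` lies in `C`, then `D ⊆ C` forces `D = C`. If not, any other element of `D` lies in `C`
  -- and precedes `b` by the choice of `t`, although `b` is the smallest element of `D`.
  by_cases hbC : b ∈ C
  · have : D ⊆ C := by
      rw [← Finset.insert_erase hb]
      exact Finset.insert_subset hbC hDs'
    exact hDC (by exact_mod_cast hD.eq_of_subset_isCircuit hC (by exact_mod_cast this))
  · obtain ⟨d, hd, hdb⟩ := Finset.exists_mem_ne (one_lt_card_of_isCircuit hloop hD) b
    exact (hbmin d hd hdb).not_gt (ht d (hDs' (Finset.mem_erase.2 ⟨hdb, hd⟩)) b hbC)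

end Groebner

end ChiAlgebra

theorem mainTheorem2 {K : Type*} [Field K] {n : ℕ} (β : Fin n → Fin n → Kˣ)
    (M : Matroid (Fin n)) (hE : M.E = Set.univ) (hloop : M.Loopless)
    (χ : Finset (Fin n) → K) (hχ : ChiAlgebra.IsChiMap β M χ) :
    ChiAlgebra.IsMinimalUniversalGroebnerBasis (ChiAlgebra.chiIdeal β M χ)
      {f | ∃ C : Finset (Fin n), M.IsCircuit (C : Set (Fin n)) ∧
        f = ChiAlgebra.boundary β χ (ChiAlgebra.mono β C)} :=
  ⟨ChiAlgebra.isGroebnerBasis_circuitBoundaries hχ hE hloop, fun _ hG hsub =>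
    ChiAlgebra.circuitBoundaries_subset_of_isUniversalGroebnerBasis hχ hloop hG hsub⟩
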